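/- Let $G$ be a finite simple graph with $v_G$ vertices and $e_G$ edges. For a graph $F$ let $q(F)$ be the number of (not necessarily induced) subgraphs of $F$ isomorphic to $G$. A nonempty set $H\subseteq E(G)$ of edges is identified with the graph formed by these $e_H$ edges and their $v_H$ endpoints, and $N(n,k,H)$ denotes the largest number of subgraphs isomorphic to $H$ in a graph with $n$ vertices and at most $k$ edges. For $p\ge 0$ put $$M^*_G(n,p):=\max\Big\{k\in\mathbb{Z}_{\ge 0} : k\le \tbinom n2,\ N(n,k,H)\le n^{v_H}p^{e_H}\ \text{ for all } \emptyset\ne H\subseteq E(G)\Big\}.$$ Theorem. There is a constant $c_G>0$, depending only on $G$, such that the following holds for every $\epsilon\in[0,1]$ and all integers $n\ge v_G$ and $0\le m\le\binom n2$ with $m\ge 9e_G^2/\epsilon$ (a condition that is dropped if $\epsilon=0$, where the bound is trivial). Let $\mathsf G_{n,m}$ be the uniform distribution on the graphs with vertex set $[n]$ and exactly $m$ edges, let $\mu:=\mathbb E_{F\leftarrow\mathsf G_{n,m}}[q(F)]$ and $p:=m/\binom n2$ (with $p:=0$ if $\binom n2=0$). Then $$\Pr_{F\leftarrow \mathsf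 G_{n,m}}\big[q(F)\ge \mu(1+\epsilon)\big]\le \exp\big(-c_G\,\epsilon^2 M^*_G(n,p)\big).$$ -/

import Mathlib

noncomputable section

/-- The number `e_F` of edges of a graph. -/
def numEdges {V : Type*} (F : SimpleGraph V) : ℕ :=
  F.edgeSet.ncard

/-- The graph determined by the edges of `H`: its vertices are the endpoints of the edges of `H`,
that is, the isolated vertices of `H` are removed. -/
def edgeGraph {V : Type*} (H : SimpleGraph V) : SimpleGraph H.support :=
  H.induce H.support

/-- `N(n, m, H)`: the largest number of (not necessarily induced, not necessarily disjoint)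
subgraphs isomorphic to `H` in a graph with vertex set `Fin n` and at most `m` edges. -/
def maxCopies {W : Type*} (n m : ℕ) (H : SimpleGraph W) : ℕ :=
  sSup {k : ℕ | ∃ F : SimpleGraph (Fin n), numEdges F ≤ m ∧ F.copyCount H = k}

/-- `M*_G(n, p)`: the largest `m ≤ n.choose 2` such that `N(n, m, H) ≤ n ^ v_H * p ^ e_H` for every
nonempty set `H` of edges of `G`, where `v_H` is the number of endpoints of edges in `H`. -/
def MStar {V : Type*} (G : SimpleGraph V) (n : ℕ) (p : ℝ) : ℕ :=
  sSup {m : ℕ | m ≤ n.choose 2 ∧ ∀ H : SimpleGraph V, H ≤ G → H ≠ ⊥ →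
    (maxCopies n m (edgeGraph H) : ℝ) ≤ (n : ℝ) ^ H.support.ncard * p ^ numEdges H}

open Classical in
/-- The set of graphs with vertex set `Fin n` and exactly `m` edges. -/
def graphsWithEdges (n m : ℕ) : Finset (SimpleGraph (Fin n)) :=
  Finset.univ.filter fun F => numEdges F = m

/-- The expectation of `f` with respect to the uniform distribution on the finite set `S`. -/
def uniformMean {Ω : Type*} (S : Finset Ω) (f : Ω → ℝ) : ℝ :=
  (∑ ω ∈ S, f ω) / (S.card : ℝ)

open Classical in
/-- The probability of `A` with respect to the uniform distribution on the finite set `S`. -/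
def uniformProb {Ω : Type*} (S : Finset Ω) (A : Set Ω) : ℝ :=
  ((S.filter fun ω => ω ∈ A).card : ℝ) / (S.card : ℝ)

end

/-! High moments. Let X count the injections of V into [n] carrying G into F, and let T be the
number of all injections. X is q(F) times the number of automorphisms of G, so both have the same
tail event. A (k+1)-st moment of X is a sum over (k+1)-tuples of injections, chosen one at a time.
Given that F contains the graph A formed by the earlier images, the expected number of next choices
is at most the sum of p ^ |φ(G) \ A|, because in a random m-set the presence of some elements only
makes others less likely. If this sum is at most R whenever A has at most k * e_G edges, then
E[X^(k+1)] ≤ R^(k+1), and Markov's inequality applies (`card_containCount_ge_le`).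

To find R, sort φ by the part H of G that it sends into A. Empty H gives the main term T * p ^ e_G.
Any other H is controlled by the number of copies of H in A. That number is at most a constant times
(e_A / M*) * N(n, M*, H), since permuted copies of A can be superposed until they have about M*
edges (`exists_copyMaps_scaling`). By definition of M*, such H contribute O(e_A / M*) * T * p ^ e_G
(`exists_sum_pow_le`). With k of order ε * M* this gives R ≤ (1 + ε/9) * T * p ^ e_G, while E[X] ≥
(1 - ε/9) * T * p ^ e_G, so each of the k + 1 factors gains exp(-ε/9). -/

/-! ### Uniformly random subsets of fixed size -/

section RandomSubset

open Finset

variable {α ι : Type*} [DecidableEq α]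

/-- The number of `m`-element subsets of `U` containing `A`. -/
def supersetCount (U : Finset α) (m : ℕ) (A : Finset α) : ℕ :=
  #{S ∈ U.powersetCard m | A ⊆ S}

lemma supersetCount_eq_choose {U A : Finset α} {m : ℕ} (hA : A ⊆ U) (hm : #A ≤ m) :
    supersetCount U m A = (#U - #A).choose (m - #A) := by
  rw [supersetCount, ← card_sdiff_of_subset hA, ← card_powersetCard]
  refine card_bij' (fun S _ => S \ A) (fun S _ => S ∪ A) ?_ ?_ ?_ ?_
  · intro S hS
    simp only [mem_filter, mem_powersetCard] at hS ⊢
    exact ⟨sdiff_subset_sdiff hS.1.1 le_rfl, by rw [card_sdiff_of_subset hS.2, hS.1.2]⟩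
  · intro S hS
    simp only [mem_filter, mem_powersetCard] at hS ⊢
    refine ⟨⟨union_subset (hS.1.trans sdiff_subset) hA, ?_⟩, subset_union_right⟩
    rw [card_union_of_disjoint (disjoint_of_subset_left hS.1 sdiff_disjoint), hS.2]
    omega
  · intro S hS
    simp only [mem_filter] at hS
    exact sdiff_union_of_subset hS.2
  · intro S hS
    simp only [mem_powersetCard] at hS
    rw [union_sdiff_right, sdiff_eq_self_of_disjoint]
    exact disjoint_of_subset_left hS.1 sdiff_disjoint

lemma supersetCount_eq_zero {U A : Finset α} {m : ℕ} (hm : m < #A) :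
    supersetCount U m A = 0 := by
  rw [supersetCount, card_eq_zero, filter_eq_empty_iff]
  intro S hS hAS
  have := card_le_card hAS
  rw [(mem_powersetCard.1 hS).2] at this
  omega

/-- Negative correlation: given A ⊆ S, the element b lies in S with probability (m - #A) / (#U - #A)
≤ m / #U. -/
lemma supersetCount_insert_mul_le {U A : Finset α} {m : ℕ} (hU : m ≤ #U) {b : α} (hb : b ∈ U)
    (hbA : b ∉ A) (hA : A ⊆ U) :
    supersetCount U m (insert b A) * #U ≤ m * supersetCount U m A := by
  have hcard := card_insert_of_notMem hbA
  rcases lt_or_ge m (#A + 1) with h | h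
  · rw [supersetCount_eq_zero (by omega)]
    simp
  have hle : #(insert b A) ≤ #U := card_le_card (insert_subset hb hA)
  rw [supersetCount_eq_choose (insert_subset hb hA) (by omega),
    supersetCount_eq_choose hA (by omega), hcard]
  obtain ⟨k, hk⟩ := Nat.exists_eq_add_of_le h
  obtain ⟨l, hl⟩ := Nat.exists_eq_add_of_le hU
  have e1 : #U - (#A + 1) = k + l := by omega
  have e2 : m - (#A + 1) = k := by omega
  have e3 : #U - #A = k + l + 1 := by omega
  have e4 : m - #A = k + 1 := by omega
  rw [e1, e2, e3, e4]
  have key := Nat.add_one_mul_choose_eq (k + l) k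
  have hcomp : (k + 1) * #U ≤ m * (k + l + 1) := by
    rw [hl, hk]; nlinarith [Nat.zero_le (#A * l)]
  refine Nat.le_of_mul_le_mul_left ?_ (show 0 < k + l + 1 by omega)
  calc (k + l + 1) * ((k + l).choose k * #U)
      = ((k + 1) * #U) * (k + l + 1).choose (k + 1) := by
        rw [← mul_assoc, key]; ring
    _ ≤ (m * (k + l + 1)) * (k + l + 1).choose (k + 1) := Nat.mul_le_mul_right _ hcomp
    _ = _ := by ring

lemma supersetCount_union_le {U : Finset α} {m : ℕ} (hU : m ≤ #U) {A B : Finset α}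
    (hA : A ⊆ U) (hB : B ⊆ U) :
    (supersetCount U m (A ∪ B) : ℝ) ≤
      supersetCount U m A * ((m : ℝ) / #U) ^ #(B \ A) := by
  rw [← union_sdiff_self_eq_union]
  have hB' : B \ A ⊆ U := sdiff_subset.trans hB
  have hd : Disjoint A (B \ A) := disjoint_sdiff
  generalize B \ A = C at *
  induction C using Finset.induction_on with
  | empty => simp
  | insert b C hbC ih =>
    have hb : b ∈ U := hB' (mem_insert_self _ _)
    have hC : C ⊆ U := (subset_insert _ _).trans hB'
    have hdC : Disjoint A C := disjoint_of_subset_right (subset_insert _ _) hd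
    have hbA : b ∉ A := fun h => disjoint_left.1 hd h (mem_insert_self _ _)
    have hpos : (0 : ℝ) < #U := by exact_mod_cast card_pos.2 ⟨b, hb⟩
    have h1 := supersetCount_insert_mul_le hU hb (A := A ∪ C) (by simp [hbA, hbC])
      (union_subset hA hC)
    have h2 : (supersetCount U m (insert b (A ∪ C)) : ℝ) * #U ≤
        m * supersetCount U m (A ∪ C) := by exact_mod_cast h1
    rw [union_insert, card_insert_of_notMem hbC, pow_succ]
    calc (supersetCount U m (insert b (A ∪ C)) : ℝ)
        ≤ m * supersetCount U m (A ∪ C) / #U := by rwa [le_div_iff₀ hpos]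
      _ = supersetCount U m (A ∪ C) * ((m : ℝ) / #U) := by ring
      _ ≤ (supersetCount U m A * ((m : ℝ) / #U) ^ #C) * ((m : ℝ) / #U) := by
        gcongr; exact ih hC hdC
      _ = _ := by ring

/-- The ratio of the binomials is a product of factors (m - i) / (N - i) with i < a ≤ e, each at
least (m - e) / N. -/
lemma choose_mul_sub_pow_le {N m e : ℕ} (he : e ≤ m) (hm : m ≤ N) {a : ℕ} (ha : a ≤ e) :
    N.choose m * (m - e) ^ a ≤ (N - a).choose (m - a) * N ^ a := by
  induction a with
  | zero => simp
  | succ a ih =>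
    have ih := ih (by omega)
    obtain ⟨k, hk⟩ := Nat.exists_eq_add_of_le (show a + 1 ≤ m by omega)
    obtain ⟨l, hl⟩ := Nat.exists_eq_add_of_le hm
    have e1 : N - (a + 1) = k + l := by omega
    have e2 : m - (a + 1) = k := by omega
    have e3 : N - a = k + l + 1 := by omega
    have e4 : m - a = k + 1 := by omega
    rw [e3, e4] at ih
    rw [e1, e2]
    have key := Nat.add_one_mul_choose_eq (k + l) k
    calc N.choose m * (m - e) ^ (a + 1) = N.choose m * (m - e) ^ a * (m - e) := by ring
      _ ≤ ((k + l + 1).choose (k + 1) * N ^ a) * (k + 1) := by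
        gcongr; omega
      _ = ((k + l + 1) * (k + l).choose k) * N ^ a := by rw [key]; ring
      _ ≤ (N * (k + l).choose k) * N ^ a := by gcongr; omega
      _ = _ := by ring

lemma supersetCount_ge {U A : Finset α} {m : ℕ} (hU : m ≤ #U) (hA : A ⊆ U) (hm : #A ≤ m)
    (hm0 : 0 < m) :
    (#U).choose m * (((m : ℝ) / #U) ^ #A * (1 - (#A : ℝ) ^ 2 / m)) ≤ supersetCount U m A := by
  have hN : (0 : ℝ) < #U := by exact_mod_cast hm0.trans_le hU
  have hmR : (0 : ℝ) < m := by exact_mod_cast hm0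
  have h := choose_mul_sub_pow_le hm hU le_rfl
  rw [← supersetCount_eq_choose hA hm] at h
  have h' : ((#U).choose m : ℝ) * ((m : ℝ) - #A) ^ #A ≤ supersetCount U m A * (#U : ℝ) ^ #A := by
    rw [← Nat.cast_sub hm]; exact_mod_cast h
  have hbern : 1 - (#A : ℝ) ^ 2 / m ≤ (1 - (#A : ℝ) / m) ^ #A := by
    have h1 : (#A : ℝ) / m ≤ 1 := by rw [div_le_one hmR]; exact_mod_cast hm
    have := one_add_mul_le_pow (a := -((#A : ℝ) / m)) (by linarith) (#A)
    calc 1 - (#A : ℝ) ^ 2 / m = 1 + #A * -((#A : ℝ) / m) := by ring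
      _ ≤ _ := this
      _ = _ := by ring
  calc (#U).choose m * (((m : ℝ) / #U) ^ #A * (1 - (#A : ℝ) ^ 2 / m))
      ≤ (#U).choose m * (((m : ℝ) / #U) ^ #A * (1 - (#A : ℝ) / m) ^ #A) := by gcongr
    _ = (#U).choose m * ((m : ℝ) - #A) ^ #A / (#U : ℝ) ^ #A := by
      rw [← mul_pow, mul_div_assoc, ← div_pow]
      congr 2
      field_simp
    _ ≤ _ := by rwa [div_le_iff₀ (by positivity)]

/-- Moment bound for the number of members of a family `B` of sets contained in a random
`m`-element subset of `U`. -/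
lemma sum_containCount_pow_le [Fintype ι] {U : Finset α} {m : ℕ} (hU : m ≤ #U)
    (B : ι → Finset α) (hB : ∀ i, B i ⊆ U) (e L : ℕ) (he : ∀ i, #(B i) = e) (R : ℝ)
    (hR : ∀ A ⊆ U, #A ≤ L → ∑ i, ((m : ℝ) / #U) ^ #(B i \ A) ≤ R) (j : ℕ) :
    ∀ A ⊆ U, #A + j * e ≤ L + e →
      ∑ S ∈ U.powersetCard m with A ⊆ S, (#{i | B i ⊆ S} : ℝ) ^ j ≤
        R ^ j * supersetCount U m A := by
  have hR0 : 0 ≤ R := (Finset.sum_nonneg fun i _ => by positivity).trans (hR ∅ (by simp) (by simp))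
  induction j with
  | zero => intro A _ _; simp [supersetCount]
  | succ j ih =>
    intro A hA hcard
    -- The budget is `L + e` rather than `L` because the last member chosen is never conditioned on.
    have hAL : #A ≤ L := by nlinarith [Nat.zero_le (j * e)]
    -- Expand one factor of the power as a sum of indicators; each adds `B i` to the conditioning
    -- set.
    have hrw : ∑ S ∈ U.powersetCard m with A ⊆ S, (#{i | B i ⊆ S} : ℝ) ^ (j + 1) =
        ∑ i, ∑ S ∈ U.powersetCard m with A ∪ B i ⊆ S, (#{i | B i ⊆ S} : ℝ) ^ j := by
      simp_rw [Finset.sum_filter]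
      rw [Finset.sum_comm]
      refine Finset.sum_congr rfl fun S _ => ?_
      simp_rw [union_subset_iff]
      by_cases hS : A ⊆ S
      · simp only [hS, true_and, if_true]
        rw [← Finset.sum_filter, Finset.sum_const, nsmul_eq_mul, pow_succ']
      · simp [hS]
    rw [hrw]
    calc ∑ i, ∑ S ∈ U.powersetCard m with A ∪ B i ⊆ S, (#{i | B i ⊆ S} : ℝ) ^ j
        ≤ ∑ i, R ^ j * (supersetCount U m A * ((m : ℝ) / #U) ^ #(B i \ A)) := by
          refine Finset.sum_le_sum fun i _ => ?_
          refine (ih _ (union_subset hA (hB i)) ?_).trans ?_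
          · have := card_union_le A (B i)
            rw [he i] at this
            nlinarith
          · gcongr
            exact supersetCount_union_le hU hA (hB i)
      _ = R ^ j * supersetCount U m A * ∑ i, ((m : ℝ) / #U) ^ #(B i \ A) := by
          rw [Finset.mul_sum]
          exact Finset.sum_congr rfl fun i _ => by ring
      _ ≤ R ^ j * supersetCount U m A * R := by
          gcongr
          exact hR A hA hAL
      _ = _ := by ring

lemma card_containCount_ge_le [Fintype ι] {U : Finset α} {m : ℕ} (hU : m ≤ #U)
    (B : ι → Finset α) (hB : ∀ i, B i ⊆ U) (e k : ℕ) (he : ∀ i, #(B i) = e) (R t : ℝ)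
    (ht : 0 < t)
    (hR : ∀ A ⊆ U, #A ≤ k * e → ∑ i, ((m : ℝ) / #U) ^ #(B i \ A) ≤ R) :
    (#{S ∈ U.powersetCard m | t ≤ (#{i | B i ⊆ S} : ℝ)} : ℝ) ≤
      (R / t) ^ (k + 1) * (#U).choose m := by
  have h := sum_containCount_pow_le hU B hB e (k * e) he R hR (k + 1) ∅ (by simp)
    (by simp [add_mul])
  have hcount : supersetCount U m ∅ = (#U).choose m := by simp [supersetCount]
  simp only [empty_subset, filter_true, hcount] at h
  rw [div_pow, div_mul_eq_mul_div, le_div_iff₀ (by positivity)]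
  refine le_trans ?_ h
  rw [card_eq_sum_ones, Nat.cast_sum, sum_mul, sum_filter]
  refine sum_le_sum fun S _ => ?_
  split_ifs with hS
  · simpa using pow_le_pow_left₀ ht.le hS (k + 1)
  · positivity

end RandomSubset

/-! ### Covering by translates under a transitive action -/

section Translates

open Finset Pointwise

variable {P Ω : Type*} [Group P] [Fintype P] [Fintype Ω] [DecidableEq Ω] [MulAction P Ω]

lemma card_filter_smul_eq_mul_card (htr : ∀ x y : Ω, ∃ g : P, g • x = y) (x y : Ω) :
    #{g : P | g • x = y} * Fintype.card Ω = Fintype.card P := by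
  have hconst : ∀ z : Ω, #{g : P | g • x = z} = #{g : P | g • x = y} := by
    intro z
    obtain ⟨h, rfl⟩ := htr y z
    refine card_bij' (fun g _ => h⁻¹ * g) (fun g _ => h * g) ?_ ?_ ?_ ?_ <;>
      simp +contextual [mul_smul]
  calc #{g : P | g • x = y} * Fintype.card Ω = ∑ z : Ω, #{g : P | g • x = z} := by
        simp [hconst, mul_comm]
    _ = Fintype.card P := by
        rw [← card_univ, ← card_eq_sum_card_fiberwise (f := fun g : P => g • x) (by simp)]

/-- Some translate of `C` meets `A` in at most the average number of points. -/
lemma exists_card_inter_smul_mul_le (htr : ∀ x y : Ω, ∃ g : P, g • x = y) (A C : Finset Ω) :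
    ∃ g : P, #(A ∩ g • C) * Fintype.card Ω ≤ #A * #C := by
  by_contra! hcon
  -- Double counting: each pair in C × A is matched by the same number |P| / |Ω| of group elements.
  have hsum : ∑ g : P, #(A ∩ g • C) * Fintype.card Ω = Fintype.card P * (#A * #C) := by
    have h1 : ∀ g : P, #(A ∩ g • C) = ∑ y ∈ A, ∑ x ∈ C, if g • x = y then 1 else 0 := by
      intro g
      rw [card_eq_sum_ones, ← filter_mem_eq_inter, sum_filter]
      refine sum_congr rfl fun y _ => ?_
      rw [← sum_filter, ← card_eq_sum_ones]
      by_cases hy : y ∈ g • C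
      · obtain ⟨x, hx, rfl⟩ := mem_smul_finset.1 hy
        rw [if_pos hy, eq_comm, card_eq_one]
        refine ⟨x, ?_⟩
        ext z
        simp only [mem_filter, smul_left_cancel_iff, mem_singleton]
        exact ⟨fun h => h.2, fun h => ⟨h.symm ▸ hx, h⟩⟩
      · rw [if_neg hy, eq_comm, card_eq_zero, filter_eq_empty_iff]
        exact fun x hx hxy => hy (hxy ▸ smul_mem_smul_finset hx)
    simp_rw [h1]
    rw [← sum_mul, sum_comm]
    simp_rw [sum_comm (s := (univ : Finset P)) (t := C)]
    simp_rw [← sum_filter, ← card_eq_sum_ones, sum_mul, card_filter_smul_eq_mul_card htr]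
    simp; ring
  have hlt : ∑ g : P, #A * #C < ∑ g : P, #(A ∩ g • C) * Fintype.card Ω :=
    sum_lt_sum_of_nonempty univ_nonempty fun g _ => hcon g
  rw [hsum] at hlt
  simp at hlt

/-- A transitive action admits `r` translates of `C` covering, up to a factor `2`, as many points
as possible. -/
lemma exists_translates_cover (htr : ∀ x y : Ω, ∃ g : P, g • x = y) (C : Finset Ω) (r : ℕ) :
    ∃ s : Finset P, #s ≤ r ∧ min (Fintype.card Ω) (r * #C) ≤ 2 * #(s.biUnion fun g => g • C) := by
  classical
  induction r with
  | zero => exact ⟨∅, by simp⟩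
  | succ r ih =>
    obtain ⟨s, hs, hcov⟩ := ih
    set A := s.biUnion fun g => g • C with hA
    rcases le_or_gt (Fintype.card Ω) (2 * #A) with hbig | hsmall
    · exact ⟨s, by omega, (min_le_left _ _).trans hbig⟩
    obtain ⟨g, hg⟩ := exists_card_inter_smul_mul_le htr A C
    refine ⟨insert g s, (card_insert_le _ _).trans (by omega), ?_⟩
    rw [biUnion_insert, ← hA]
    have hun := card_union_add_card_inter (g • C) A
    rw [inter_comm, card_smul_finset] at hun
    -- While A covers less than half of Ω, at least half of the new translate is new.
    have hint : 2 * #(A ∩ g • C) ≤ #C := by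
      have h2 : (2 * #(A ∩ g • C)) * Fintype.card Ω ≤ #C * Fintype.card Ω := by
        nlinarith
      exact Nat.le_of_mul_le_mul_right h2 (by omega)
    have : r * #C ≤ 2 * #A := by
      rcases min_le_iff.1 hcov with h | h
      · omega
      · exact h
    refine (min_le_right _ _).trans ?_
    rw [add_mul]
    omega

end Translates

/-! ### Labelled copies -/

section Labelled

open Finset

variable {W X : Type*} [Fintype W] [Fintype X]

open Classical in
/-- The injections `W ↪ X` mapping the edges of `H` to edges of `F`. -/
noncomputable def copyMaps (F : SimpleGraph X) (H : SimpleGraph W) : Finset (W ↪ X) :=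
  univ.filter fun φ => H.map φ ≤ F

lemma mem_copyMaps {F : SimpleGraph X} {H : SimpleGraph W} {φ : W ↪ X} :
    φ ∈ copyMaps F H ↔ H.map φ ≤ F := by
  simp [copyMaps]

lemma card_copyMaps_eq_labelledCopyCount (F : SimpleGraph X) (H : SimpleGraph W) :
    #(copyMaps F H) = F.labelledCopyCount H := by
  classical
  rw [SimpleGraph.labelledCopyCount, ← card_univ]
  refine (card_bij (fun c _ => c.toEmbedding) ?_ ?_ ?_).symm
  · intro c _
    rw [mem_copyMaps, SimpleGraph.map_le_iff_le_comap]
    intro a b hab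
    exact c.toHom.map_adj hab
  · intro c _ d _ h
    ext a
    exact DFunLike.congr_fun h a
  · intro φ hφ
    rw [mem_copyMaps, SimpleGraph.map_le_iff_le_comap] at hφ
    exact ⟨⟨⟨φ, fun h => hφ h⟩, φ.injective⟩, mem_univ _, rfl⟩

/-- The copies of `H` with image the subgraph `F'` correspond to the isomorphisms onto `F'`. -/
lemma natCard_copy_fiber {W X : Type*} (F : SimpleGraph X) (H : SimpleGraph W) (F' : F.Subgraph) :
    Nat.card {c : H.Copy F // c.toSubgraph = F'} = Nat.card (H ≃g F'.coe) := by
  refine (Nat.card_congr (Equiv.ofBijective (fun e : H ≃g F'.coe =>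
    (⟨⟨F'.hom.comp e.toHom, SimpleGraph.Subgraph.hom_injective.comp e.injective⟩, by
      simp [SimpleGraph.Copy.toSubgraph, SimpleGraph.Subgraph.map_comp]⟩ :
      {c : H.Copy F // c.toSubgraph = F'})) ⟨?_, ?_⟩)).symm
  · intro e e' h
    ext a
    have := congrArg (fun c : {c : H.Copy F // c.toSubgraph = F'} => c.1 a) h
    exact this
  · rintro ⟨c, rfl⟩
    exact ⟨c.isoToSubgraph, rfl⟩

/-- Every nonempty fibre of the map from copies to their image subgraphs is a torsor under the
automorphisms of H. -/
lemma labelledCopyCount_eq_copyCount_mul (F : SimpleGraph X) (H : SimpleGraph W) :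
    F.labelledCopyCount H = F.copyCount H * Nat.card (H ≃g H) := by
  classical
  rw [SimpleGraph.labelledCopyCount, SimpleGraph.copyCount_eq_card_image_copyToSubgraph,
    ← card_univ, card_eq_sum_card_image SimpleGraph.Copy.toSubgraph, sum_const_nat]
  intro F' hF'
  obtain ⟨c, -, hc⟩ := mem_image.1 hF'
  have e : H ≃g F'.coe := hc ▸ c.isoToSubgraph
  rw [← Fintype.card_subtype, ← Nat.card_eq_fintype_card, natCard_copy_fiber]
  exact Nat.card_congr ⟨fun f => f.trans e.symm, fun f => f.trans e,
    fun f => by ext; simp, fun f => by ext; simp⟩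

lemma card_copyMaps_eq_copyCount_mul (F : SimpleGraph X) (H : SimpleGraph W) :
    #(copyMaps F H) = F.copyCount H * Nat.card (H ≃g H) := by
  rw [card_copyMaps_eq_labelledCopyCount, labelledCopyCount_eq_copyCount_mul]

lemma natCard_iso_self_pos (H : SimpleGraph W) : 0 < Nat.card (H ≃g H) := by
  have : Finite (H ≃g H) := Finite.of_injective (fun e => (e : W → W)) DFunLike.coe_injective
  have : Nonempty (H ≃g H) := ⟨.refl⟩
  exact Nat.card_pos

/-- A set of injections is small if the values on the vertices satisfying `p` are determined by an
element of a small set. -/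
lemma card_embedding_le_of_determined [DecidableEq X] {Y : Type*} (p : W → Prop) [DecidablePred p]
    (S : Finset (W ↪ X)) (D : Finset Y) (f : (W ↪ X) → Y) (hf : ∀ φ ∈ S, f φ ∈ D)
    (hinj : ∀ φ ψ, f φ = f ψ → ∀ v, p v → φ v = ψ v) :
    #S ≤ #D * Fintype.card X ^ Fintype.card {v // ¬ p v} := by
  classical
  have : #(D ×ˢ (univ : Finset ({v // ¬ p v} → X))) =
      #D * Fintype.card X ^ Fintype.card {v // ¬ p v} := by
    rw [card_product, card_univ, Fintype.card_fun]
  rw [← this]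
  refine card_le_card_of_injOn (fun φ => (f φ, fun v => φ v)) ?_ ?_
  · intro φ hφ
    simpa using hf φ hφ
  · intro φ _ ψ _ h
    rw [Prod.mk.injEq] at h
    ext v
    by_cases hv : p v
    · exact hinj φ ψ h.1 v hv
    · exact congrFun h.2 ⟨v, hv⟩

/-- One edge of K must land on one of the 2 * e_F darts of F; the other vertices are free. -/
lemma card_copyMaps_mul_sq_le (F : SimpleGraph X) {K : SimpleGraph W} (hK : K ≠ ⊥) :
    #(copyMaps F K) * Fintype.card X ^ 2 ≤
      2 * numEdges F * Fintype.card X ^ Fintype.card W := by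
  classical
  obtain ⟨a, b, hab⟩ := SimpleGraph.ne_bot_iff_exists_adj.1 hK
  have h := card_embedding_le_of_determined (fun v => v = a ∨ v = b) (copyMaps F K)
    ((univ : Finset F.Dart).image fun d => (d.fst, d.snd)) (fun φ => (φ a, φ b))
    (by
      intro φ hφ
      rw [mem_copyMaps, SimpleGraph.map_le_iff_le_comap] at hφ
      exact mem_image.2 ⟨⟨(φ a, φ b), hφ hab⟩, mem_univ _, rfl⟩)
    (by
      rintro φ ψ h v (rfl | rfl)
      · exact congrArg Prod.fst h
      · exact congrArg Prod.snd h)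
  have hD : #((univ : Finset F.Dart).image fun d => (d.fst, d.snd)) ≤ 2 * numEdges F := by
    refine card_image_le.trans ?_
    rw [card_univ, SimpleGraph.dart_card_eq_twice_card_edges, numEdges,
      ← SimpleGraph.coe_edgeFinset, Set.ncard_coe_finset]
  have hcard : Fintype.card {v // ¬ (v = a ∨ v = b)} + 2 = Fintype.card W := by
    have h1 := Fintype.card_subtype_compl (fun v => v = a ∨ v = b)
    have h2 : Fintype.card {v // v = a ∨ v = b} = 2 := by
      rw [Fintype.card_subtype, ← card_pair hab.ne]
      congr 1
      ext v
      simp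
    have h3 := Fintype.card_subtype_le (fun v => v = a ∨ v = b)
    omega
  calc #(copyMaps F K) * Fintype.card X ^ 2
      ≤ (2 * numEdges F * Fintype.card X ^ Fintype.card {v // ¬ (v = a ∨ v = b)}) *
        Fintype.card X ^ 2 := by
        gcongr
        exact h.trans (Nat.mul_le_mul_right _ hD)
    _ = _ := by rw [mul_assoc, ← pow_add, hcard]

end Labelled

/-! ### Scaling of the extremal number of copies -/

section Scaling

open Finset Pointwise

lemma numEdges_mono {X : Type*} [Finite X] {F F' : SimpleGraph X} (h : F ≤ F') :
    numEdges F ≤ numEdges F' :=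
  Set.ncard_le_ncard (SimpleGraph.edgeSet_mono h) (Set.toFinite _)

lemma numEdges_map {W X : Type*} (φ : W ↪ X) (F : SimpleGraph W) :
    numEdges (F.map φ) = numEdges F := by
  rw [numEdges, SimpleGraph.edgeSet_map, Set.ncard_image_of_injective _ φ.sym2Map.injective,
    numEdges]

lemma numEdges_finset_sup_le {ι X : Type*} [Finite X] (s : Finset ι) (F : ι → SimpleGraph X)
    (j : ℕ) (hF : ∀ i ∈ s, numEdges (F i) ≤ j) : numEdges (s.sup F) ≤ #s * j := by
  classical
  induction s using Finset.induction_on with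
  | empty => simp [numEdges]
  | insert i s hi ih =>
    rw [sup_insert, card_insert_of_notMem hi, numEdges, SimpleGraph.edgeSet_sup]
    refine (Set.ncard_union_le _ _).trans ?_
    have h1 := hF i (mem_insert_self _ _)
    have h2 := ih fun i hi => hF i (mem_insert_of_mem hi)
    rw [numEdges] at h1 h2
    linarith

lemma pow_le_pow_mul_descFactorial {n w : ℕ} (h : w ≤ n) :
    n ^ w ≤ w ^ w * n.descFactorial w := by
  rcases Nat.eq_zero_or_pos w with rfl | hw
  · simp
  calc n ^ w ≤ (w * (n + 1 - w)) ^ w := by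
        gcongr
        obtain ⟨a, rfl⟩ := Nat.exists_eq_add_of_le h
        have : w + a + 1 - w = a + 1 := by omega
        rw [this]
        nlinarith
    _ ≤ _ := by
        rw [mul_pow]
        gcongr
        exact n.pow_sub_le_descFactorial w

variable {W : Type*} [Fintype W]

/-- F' superposes at most `k / j` vertex-permuted copies of F with little overlap among their copies
of K. In the constant, one factor 2 is lost in rounding `k / j`, another in the covering, and w ^ w
in comparing n ^ w with the number of injections. -/
lemma exists_copyMaps_scaling {K : SimpleGraph W} (hK : K ≠ ⊥) {n : ℕ}
    (hn : Fintype.card W ≤ n) {j k : ℕ} (hj : 0 < j) (hjk : j ≤ k) (hk : k ≤ n.choose 2)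
    (F : SimpleGraph (Fin n)) (hF : numEdges F ≤ j) :
    ∃ F' : SimpleGraph (Fin n), numEdges F' ≤ k ∧
      #(copyMaps F K) * k ≤
        4 * Fintype.card W ^ Fintype.card W * j * #(copyMaps F' K) := by
  classical
  set w := Fintype.card W
  obtain ⟨s, hs, hcov⟩ := exists_translates_cover (P := Equiv.Perm (Fin n)) (Ω := W ↪ Fin n)
    (fun x y => Equiv.Perm.exists_smul_eq_embedding x y) (copyMaps F K) (k / j)
  refine ⟨s.sup fun g => F.map g.toEmbedding, ?_, ?_⟩
  · refine (numEdges_finset_sup_le s _ j fun g _ => ?_).trans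
      ((Nat.mul_le_mul_right _ hs).trans (Nat.div_mul_le_self k j))
    rwa [numEdges_map]
  set F' := s.sup fun g => F.map g.toEmbedding
  have hsub : (s.biUnion fun g => g • copyMaps F K) ⊆ copyMaps F' K := by
    intro φ hφ
    obtain ⟨g, hg, hφ⟩ := mem_biUnion.1 hφ
    obtain ⟨ψ, hψ, rfl⟩ := mem_smul_finset.1 hφ
    rw [mem_copyMaps] at hψ ⊢
    have h1 : F.map g.toEmbedding ≤ F' := le_sup (f := fun g : Equiv.Perm (Fin n) =>
      F.map g.toEmbedding) hg
    refine le_trans ?_ h1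
    rw [SimpleGraph.map_le_iff_le_comap] at hψ ⊢
    intro a b hab
    exact (SimpleGraph.map_adj _ _ _ _).2 ⟨ψ a, ψ b, hψ hab, rfl, rfl⟩
  have hcov' := hcov.trans (Nat.mul_le_mul_left 2 (card_le_card hsub))
  rw [Fintype.card_embedding_eq, Fintype.card_fin] at hcov'
  set L := #(copyMaps F K)
  set r := k / j
  have hr1 : r * j ≤ k := Nat.div_mul_le_self k j
  have hr2 : k ≤ 2 * r * j := by
    have h1 : k < r * j + j := Nat.lt_div_mul_add hj
    have h2 : 1 ≤ r := Nat.div_pos hjk hj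
    nlinarith
  have hww : 0 < w ^ w := Nat.pow_self_pos
  -- the translates never saturate the set of all injections, up to a constant
  have hsat : r * L ≤ w ^ w * n.descFactorial w := by
    refine le_trans ?_ (pow_le_pow_mul_descFactorial hn)
    have h1 : L * n ^ 2 ≤ 2 * j * n ^ w := by
      have := card_copyMaps_mul_sq_le F hK
      rw [Fintype.card_fin] at this
      exact this.trans (by gcongr)
    have h2 : 2 * k ≤ n ^ 2 := by
      have h3 : n.choose 2 * 2 ≤ n ^ 2 := by
        rw [Nat.choose_two_right]
        refine (Nat.div_mul_le_self _ _).trans ?_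
        rw [sq]
        gcongr
        omega
      omega
    refine Nat.le_of_mul_le_mul_right (c := n ^ 2) ?_ (by omega)
    calc r * L * n ^ 2 ≤ r * (2 * j * n ^ w) := by
          rw [mul_assoc]; gcongr
      _ = 2 * (r * j) * n ^ w := by ring
      _ ≤ 2 * k * n ^ w := by gcongr
      _ ≤ n ^ w * n ^ 2 := by rw [mul_comm (n ^ w)]; gcongr
  have hmain : r * L ≤ w ^ w * (2 * #(copyMaps F' K)) := by
    rcases min_le_iff.1 hcov' with h | h
    · exact hsat.trans (by gcongr)
    · exact h.trans (Nat.le_mul_of_pos_left _ hww)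
  calc L * k ≤ L * (2 * r * j) := by gcongr
    _ = 2 * j * (r * L) := by ring
    _ ≤ 2 * j * (w ^ w * (2 * #(copyMaps F' K))) := by gcongr
    _ = _ := by ring

lemma copyCount_le_maxCopies {W : Type*} {n m : ℕ} (K : SimpleGraph W) (F : SimpleGraph (Fin n))
    (hF : numEdges F ≤ m) : F.copyCount K ≤ maxCopies n m K := by
  refine le_csSup (Set.Finite.bddAbove ?_) ⟨F, hF, rfl⟩
  refine (Set.finite_range fun F : SimpleGraph (Fin n) => F.copyCount K).subset ?_
  rintro _ ⟨F, -, rfl⟩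
  exact ⟨F, rfl⟩

lemma maxCopies_zero {W : Type*} (n : ℕ) {K : SimpleGraph W} (hK : K ≠ ⊥) : maxCopies n 0 K = 0 := by
  refine Nat.le_zero.1 (csSup_le' ?_)
  rintro _ ⟨F, hF, rfl⟩
  have : F = ⊥ := by
    rw [← SimpleGraph.edgeSet_eq_empty]
    exact (Set.ncard_eq_zero (Set.toFinite _)).1 (Nat.le_zero.1 hF)
  rw [this]
  exact (SimpleGraph.copyCount_eq_zero.2 (SimpleGraph.free_bot hK)).le

/-- A graph with few edges compared to `k` has proportionally few copies of `K` compared to the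
extremal number for `k` edges. -/
lemma card_copyMaps_mul_le_maxCopies {K : SimpleGraph W} (hK : K ≠ ⊥) {n : ℕ}
    (hn : Fintype.card W ≤ n) {k : ℕ} (hk : k ≤ n.choose 2)
    (F : SimpleGraph (Fin n)) (hF : numEdges F ≤ k) :
    #(copyMaps F K) * k ≤
      4 * Fintype.card W ^ Fintype.card W * Nat.card (K ≃g K) * numEdges F * maxCopies n k K := by
  rcases Nat.eq_zero_or_pos (numEdges F) with h0 | hpos
  · have := copyCount_le_maxCopies K F h0.le
    rw [maxCopies_zero n hK] at this
    rw [card_copyMaps_eq_copyCount_mul, Nat.le_zero.1 this]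
    simp
  obtain ⟨F', hF', h⟩ := exists_copyMaps_scaling hK hn hpos hF hk F le_rfl
  refine h.trans ?_
  rw [card_copyMaps_eq_copyCount_mul]
  calc _ ≤ 4 * Fintype.card W ^ Fintype.card W * numEdges F *
        (maxCopies n k K * Nat.card (K ≃g K)) := by
        gcongr
        exact copyCount_le_maxCopies K F' hF'
    _ = _ := by ring

end Scaling

/-! ### Weighted count of copies meeting a fixed graph -/

section WeightedCount

open Finset

variable {V X : Type*} [Fintype V] [Fintype X]

lemma numEdges_sdiff_add_numEdges {G H : SimpleGraph V} (h : H ≤ G) :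
    numEdges (G \ H) + numEdges H = numEdges G := by
  rw [numEdges, numEdges, numEdges, SimpleGraph.edgeSet_sdiff]
  exact Set.ncard_sdiff_add_ncard_of_subset (SimpleGraph.edgeSet_mono h) (Set.toFinite _)

lemma numEdges_map_sdiff {X : Type*} (φ : V ↪ X) (G : SimpleGraph V) (F : SimpleGraph X) :
    numEdges (G.map φ \ F) = numEdges G - numEdges (G ⊓ F.comap φ) := by
  have h : G.map φ \ F = (G \ (G ⊓ F.comap φ)).map φ := by
    ext x y
    simp only [SimpleGraph.sdiff_adj, SimpleGraph.map_adj, SimpleGraph.inf_adj,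
      SimpleGraph.comap_adj]
    constructor
    · rintro ⟨⟨a, b, hab, rfl, rfl⟩, hF⟩
      exact ⟨a, b, ⟨hab, fun h => hF h.2⟩, rfl, rfl⟩
    · rintro ⟨a, b, ⟨hab, hF⟩, rfl, rfl⟩
      exact ⟨⟨a, b, hab, rfl, rfl⟩, fun h => hF ⟨hab, h⟩⟩
  rw [h, numEdges_map, ← numEdges_sdiff_add_numEdges (inf_le_left : G ⊓ F.comap φ ≤ G),
    Nat.add_sub_cancel]

lemma edgeGraph_ne_bot {V : Type*} {H : SimpleGraph V} (hH : H ≠ ⊥) : edgeGraph H ≠ ⊥ := by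
  obtain ⟨a, b, hab⟩ := SimpleGraph.ne_bot_iff_exists_adj.1 hH
  rw [SimpleGraph.ne_bot_iff_exists_adj]
  exact ⟨⟨a, b, hab⟩, ⟨b, a, hab.symm⟩, hab⟩

open Classical in
-- Restricted to the support of H, such a φ is a labelled copy of H in F; its other values are
-- unconstrained.
lemma card_filter_inf_comap_eq_le (G H : SimpleGraph V) (F : SimpleGraph X) :
    #{φ : V ↪ X | G ⊓ F.comap φ = H} ≤
      #(copyMaps F (edgeGraph H)) *
        Fintype.card X ^ (Fintype.card V - H.support.ncard) := by
  have h := card_embedding_le_of_determined (fun v => v ∈ H.support)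
    ({φ : V ↪ X | G ⊓ F.comap φ = H} : Finset (V ↪ X)) (copyMaps F (edgeGraph H))
    (fun φ => (Function.Embedding.subtype _).trans φ)
    (by
      intro φ hφ
      rw [mem_filter] at hφ
      rw [mem_copyMaps, SimpleGraph.map_le_iff_le_comap]
      intro a b hab
      have hab' : H.Adj a b := hab
      exact (hφ.2.ge hab').2)
    (by
      intro φ ψ h v hv
      exact DFunLike.congr_fun h (⟨v, hv⟩ : {v // v ∈ H.support}))
  have hcard : Fintype.card {v // ¬ v ∈ H.support} = Fintype.card V - H.support.ncard := by
    rw [Fintype.card_subtype_compl]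
    congr 1
    rw [← Nat.card_eq_fintype_card]
    exact Nat.card_coe_set_eq _
  rwa [hcard] at h

open Classical in
-- Split by the overlap H = `G ⊓ F.comap φ`. For H ≠ ⊥ the powers of n and p from the copies of H
-- and from the rest of G recombine to those of G, so each overlap costs the same.
lemma sum_pow_numEdges_map_sdiff_le (G : SimpleGraph V) (F : SimpleGraph X) {p η : ℝ}
    (hp : 0 ≤ p) (hη : 0 ≤ η)
    (hF : ∀ H ≤ G, H ≠ ⊥ → (#(copyMaps F (edgeGraph H)) : ℝ) ≤
      η * (Fintype.card X ^ H.support.ncard * p ^ numEdges H)) :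
    ∑ φ : V ↪ X, p ^ numEdges (G.map φ \ F) ≤
      Fintype.card (V ↪ X) * p ^ numEdges G +
        Nat.card (SimpleGraph V) *
          (η * (Fintype.card X ^ Fintype.card V * p ^ numEdges G)) := by
  set D := η * ((Fintype.card X : ℝ) ^ Fintype.card V * p ^ numEdges G) with hD
  have hD0 : 0 ≤ D := by positivity
  have hterm : ∀ H : SimpleGraph V,
      ∑ φ ∈ univ.filter (fun φ : V ↪ X => G ⊓ F.comap φ = H), p ^ numEdges (G.map φ \ F) ≤
        (if H = ⊥ then Fintype.card (V ↪ X) * p ^ numEdges G else 0) + D := by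
    intro H
    have hsum : ∑ φ ∈ univ.filter (fun φ : V ↪ X => G ⊓ F.comap φ = H), p ^ numEdges (G.map φ \ F) =
        #{φ : V ↪ X | G ⊓ F.comap φ = H} * p ^ (numEdges G - numEdges H) := by
      rw [← nsmul_eq_mul, ← sum_const]
      refine sum_congr rfl fun φ hφ => ?_
      rw [numEdges_map_sdiff, (mem_filter.1 hφ).2]
    rw [hsum]
    by_cases hbot : H = ⊥
    · rw [if_pos hbot]
      have h0 : numEdges H = 0 := by rw [hbot]; simp [numEdges]
      rw [h0, Nat.sub_zero]
      refine le_trans ?_ (le_add_of_nonneg_right hD0)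
      gcongr
      exact card_le_univ _
    rw [if_neg hbot, zero_add]
    by_cases hHG : H ≤ G
    · have hle : numEdges H ≤ numEdges G := numEdges_mono hHG
      have hsupp : H.support.ncard ≤ Fintype.card V := by
        rw [← Nat.card_eq_fintype_card]
        exact Set.ncard_le_card _
      have h1 : (#{φ : V ↪ X | G ⊓ F.comap φ = H} : ℝ) ≤
          #(copyMaps F (edgeGraph H)) *
            (Fintype.card X : ℝ) ^ (Fintype.card V - H.support.ncard) := by
        exact_mod_cast card_filter_inf_comap_eq_le G H F
      calc (#{φ : V ↪ X | G ⊓ F.comap φ = H} : ℝ) * p ^ (numEdges G - numEdges H)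
          ≤ ((η * (Fintype.card X ^ H.support.ncard * p ^ numEdges H)) *
            (Fintype.card X : ℝ) ^ (Fintype.card V - H.support.ncard)) *
              p ^ (numEdges G - numEdges H) := by
            gcongr
            exact h1.trans (by gcongr; exact hF H hHG hbot)
        _ = η * (((Fintype.card X : ℝ) ^ H.support.ncard *
              (Fintype.card X : ℝ) ^ (Fintype.card V - H.support.ncard)) *
              (p ^ numEdges H * p ^ (numEdges G - numEdges H))) := by ring
        _ = D := by
            rw [← pow_add, ← pow_add, Nat.add_sub_cancel' hsupp, Nat.add_sub_cancel' hle]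
    · have : ({φ : V ↪ X | G ⊓ F.comap φ = H} : Finset (V ↪ X)) = ∅ := by
        rw [filter_eq_empty_iff]
        rintro φ - rfl
        exact hHG inf_le_left
      rw [this]
      simpa using hD0
  rw [← sum_fiberwise (s := (univ : Finset (V ↪ X))) (g := fun φ => G ⊓ F.comap φ)]
  refine (sum_le_sum fun H _ => hterm H).trans ?_
  rw [sum_add_distrib, sum_ite_eq' univ (⊥ : SimpleGraph V), if_pos (mem_univ _), sum_const,
    nsmul_eq_mul, card_univ, Nat.card_eq_fintype_card]

end WeightedCount

/-! ### Uniformly random graphs as random edge sets -/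

section RandomGraph

open Finset

open Classical in
/-- The finite set of edges of a graph. -/
noncomputable def edges {X : Type*} [Fintype X] (F : SimpleGraph X) : Finset (Sym2 X) :=
  F.edgeFinset

variable {V X : Type*} [Fintype V] [Fintype X]

lemma coe_edges (F : SimpleGraph X) : (edges F : Set (Sym2 X)) = F.edgeSet := by
  simp [edges]

lemma card_edges (F : SimpleGraph X) : #(edges F) = numEdges F := by
  rw [numEdges, ← coe_edges, Set.ncard_coe_finset]

lemma edges_subset_edges {F F' : SimpleGraph X} : edges F ⊆ edges F' ↔ F ≤ F' := by
  rw [← coe_subset, coe_edges, coe_edges, SimpleGraph.edgeSet_subset_edgeSet]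

lemma edges_injective : Function.Injective (edges : SimpleGraph X → Finset (Sym2 X)) :=
  fun _ _ h => le_antisymm (edges_subset_edges.1 h.subset) (edges_subset_edges.1 h.superset)

lemma exists_edges_eq {S : Finset (Sym2 X)} (hS : S ⊆ edges (⊤ : SimpleGraph X)) :
    ∃ F : SimpleGraph X, edges F = S := by
  refine ⟨SimpleGraph.fromEdgeSet S, coe_injective ?_⟩
  rw [coe_edges, SimpleGraph.edgeSet_fromEdgeSet, sdiff_eq_left, Set.disjoint_left]
  intro e he
  have : e ∈ (⊤ : SimpleGraph X).edgeSet := by rw [← coe_edges]; exact hS he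
  simpa using this

lemma card_edges_sdiff [DecidableEq (Sym2 X)] (F F' : SimpleGraph X) :
    #(edges F \ edges F') = numEdges (F \ F') := by
  rw [← card_edges]
  congr 1
  apply coe_injective
  rw [coe_sdiff, coe_edges, coe_edges, coe_edges, SimpleGraph.edgeSet_sdiff]

lemma card_edges_top (n : ℕ) : #(edges (⊤ : SimpleGraph (Fin n))) = n.choose 2 := by
  classical
  have := SimpleGraph.card_edgeFinset_top_eq_card_choose_two (V := Fin n)
  rw [Fintype.card_fin] at this
  rw [← this, edges]
  congr!

lemma sum_graphsWithEdges (n m : ℕ) (f : Finset (Sym2 (Fin n)) → ℝ) :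
    ∑ F ∈ graphsWithEdges n m, f (edges F) =
      ∑ S ∈ (edges (⊤ : SimpleGraph (Fin n))).powersetCard m, f S := by
  classical
  refine sum_bij (fun F _ => edges F) ?_ ?_ ?_ ?_
  · intro F hF
    rw [mem_powersetCard, card_edges]
    exact ⟨edges_subset_edges.2 le_top, (mem_filter.1 hF).2⟩
  · exact fun F _ F' _ h => edges_injective h
  · intro S hS
    rw [mem_powersetCard] at hS
    obtain ⟨F, rfl⟩ := exists_edges_eq hS.1
    exact ⟨F, mem_filter.2 ⟨mem_univ _, by rw [← card_edges, hS.2]⟩, rfl⟩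
  · exact fun F _ => rfl

lemma card_graphsWithEdges (n m : ℕ) : #(graphsWithEdges n m) = (n.choose 2).choose m := by
  have := sum_graphsWithEdges n m fun _ => 1
  simp only [sum_const, nsmul_eq_mul, mul_one, card_powersetCard, card_edges_top] at this
  exact_mod_cast this

lemma card_copyMaps_eq_containCount [DecidableEq (Sym2 X)] (F : SimpleGraph X)
    (G : SimpleGraph V) : #(copyMaps F G) = #{φ : V ↪ X | edges (G.map φ) ⊆ edges F} := by
  classical
  rw [copyMaps]
  congr 1
  ext φ
  simp [edges_subset_edges]

end RandomGraph

/-! ### The upper tail bound -/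

section UpperTail

open Finset

variable {V : Type*} [Fintype V]

/-- The supremum is attained: the set is bounded, and it contains 0 because an edgeless graph has no
copies of a nonempty H. -/
lemma MStar_spec {V : Type*} (G : SimpleGraph V) (n : ℕ) {p : ℝ} (hp : 0 ≤ p) :
    MStar G n p ≤ n.choose 2 ∧ ∀ H : SimpleGraph V, H ≤ G → H ≠ ⊥ →
      (maxCopies n (MStar G n p) (edgeGraph H) : ℝ) ≤
        (n : ℝ) ^ H.support.ncard * p ^ numEdges H := by
  have hmem := Nat.sSup_mem (s := {m : ℕ | m ≤ n.choose 2 ∧ ∀ H : SimpleGraph V, H ≤ G → H ≠ ⊥ →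
    (maxCopies n m (edgeGraph H) : ℝ) ≤ (n : ℝ) ^ H.support.ncard * p ^ numEdges H})
    ⟨0, Nat.zero_le _, fun H _ hH => by
      rw [maxCopies_zero n (edgeGraph_ne_bot hH)]
      simp only [Nat.cast_zero]
      positivity⟩
    ⟨n.choose 2, fun m hm => hm.1⟩
  exact hmem

open Classical in
/-- The constant comparing labelled copies in sparse graphs with the extremal number. -/
noncomputable def scalingConst (H : SimpleGraph V) : ℕ :=
  4 * Fintype.card H.support ^ Fintype.card H.support * Nat.card (edgeGraph H ≃g edgeGraph H)

open Classical in
lemma card_copyMaps_edgeGraph_le (G : SimpleGraph V) {n : ℕ} (hn : Fintype.card V ≤ n) {p : ℝ}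
    (hp : 0 ≤ p) (hM : 0 < MStar G n p) (F : SimpleGraph (Fin n))
    (hF : numEdges F ≤ MStar G n p) {H : SimpleGraph V} (hHG : H ≤ G) (hH : H ≠ ⊥) :
    (#(copyMaps F (edgeGraph H)) : ℝ) ≤
      (scalingConst H * (numEdges F / MStar G n p : ℝ)) *
        ((n : ℝ) ^ H.support.ncard * p ^ numEdges H) := by
  obtain ⟨hle, hN⟩ := MStar_spec G n hp
  have hMR : (0 : ℝ) < MStar G n p := by exact_mod_cast hM
  have h := card_copyMaps_mul_le_maxCopies (edgeGraph_ne_bot hH)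
    ((Fintype.card_subtype_le _).trans hn) hle F hF
  have h' : (#(copyMaps F (edgeGraph H)) : ℝ) * MStar G n p ≤
      scalingConst H * numEdges F * maxCopies n (MStar G n p) (edgeGraph H) := by
    exact_mod_cast h
  calc (#(copyMaps F (edgeGraph H)) : ℝ)
      ≤ scalingConst H * numEdges F * maxCopies n (MStar G n p) (edgeGraph H) / MStar G n p := by
        rwa [le_div_iff₀ hMR]
    _ ≤ scalingConst H * numEdges F * ((n : ℝ) ^ H.support.ncard * p ^ numEdges H) /
          MStar G n p := by
        gcongr
        exact hN H hHG hH
    _ = _ := by ring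

/-- The bound R of the moment method. C collects the number of overlap patterns, their scaling
constants, and v ^ v from replacing n ^ v by the number of injections. -/
lemma exists_sum_pow_le (G : SimpleGraph V) :
    ∃ C : ℝ, 0 ≤ C ∧ ∀ (n : ℕ) (p : ℝ), Fintype.card V ≤ n → 0 ≤ p → 0 < MStar G n p →
      ∀ F : SimpleGraph (Fin n), numEdges F ≤ MStar G n p →
        ∑ φ : V ↪ Fin n, p ^ numEdges (G.map φ \ F) ≤
          Fintype.card (V ↪ Fin n) * p ^ numEdges G *
            (1 + C * (numEdges F / MStar G n p : ℝ)) := by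
  classical
  set v := Fintype.card V with hv
  set C₀ : ℕ := ∑ H : SimpleGraph V, scalingConst H
  refine ⟨Nat.card (SimpleGraph V) * C₀ * v ^ v, by positivity, ?_⟩
  intro n p hn hp hM F hF
  have h := sum_pow_numEdges_map_sdiff_le G F hp
    (η := C₀ * (numEdges F / MStar G n p : ℝ)) (by positivity) (by
      intro H hHG hH
      refine (card_copyMaps_edgeGraph_le G hn hp hM F hF hHG hH).trans ?_
      rw [Fintype.card_fin]
      gcongr
      exact single_le_sum (f := scalingConst) (fun _ _ => Nat.zero_le _) (mem_univ H))
  refine h.trans ?_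
  have hpow : (n : ℝ) ^ v ≤ v ^ v * Fintype.card (V ↪ Fin n) := by
    rw [Fintype.card_embedding_eq, Fintype.card_fin]
    exact_mod_cast pow_le_pow_mul_descFactorial hn
  rw [Fintype.card_fin, mul_add, mul_one]
  refine add_le_add le_rfl ?_
  calc (Nat.card (SimpleGraph V) : ℝ) * (C₀ * (numEdges F / MStar G n p : ℝ) *
        ((n : ℝ) ^ v * p ^ numEdges G))
      ≤ (Nat.card (SimpleGraph V) : ℝ) * (C₀ * (numEdges F / MStar G n p : ℝ) *
        ((v ^ v * Fintype.card (V ↪ Fin n)) * p ^ numEdges G)) := by gcongr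
    _ = _ := by ring

lemma uniformProb_le_one {Ω : Type*} (S : Finset Ω) (A : Set Ω) : uniformProb S A ≤ 1 := by
  classical
  rw [uniformProb]
  refine div_le_one_of_le₀ ?_ (Nat.cast_nonneg _)
  exact_mod_cast card_filter_le _ _

lemma uniformProb_mono {Ω : Type*} (S : Finset Ω) {A B : Set Ω} (h : A ⊆ B) :
    uniformProb S A ≤ uniformProb S B := by
  classical
  rw [uniformProb, uniformProb]
  refine div_le_div_of_nonneg_right ?_ (Nat.cast_nonneg _)
  exact_mod_cast card_le_card (monotone_filter_right S fun _ _ hω => h hω)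

lemma uniformMean_copyMaps_ge (G : SimpleGraph V) {n m : ℕ} (hm : m ≤ n.choose 2)
    (hm0 : 0 < m) (he : numEdges G ≤ m) :
    Fintype.card (V ↪ Fin n) * ((m : ℝ) / n.choose 2) ^ numEdges G *
        (1 - (numEdges G : ℝ) ^ 2 / m) ≤
      uniformMean (graphsWithEdges n m) fun F => (#(copyMaps F G) : ℝ) := by
  classical
  set U := edges (⊤ : SimpleGraph (Fin n)) with hU
  have hUc : #U = n.choose 2 := card_edges_top n
  have hpos : (0 : ℝ) < (n.choose 2).choose m := by exact_mod_cast Nat.choose_pos hm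
  rw [uniformMean, card_graphsWithEdges, le_div_iff₀ hpos]
  have hsum : ∑ F ∈ graphsWithEdges n m, (#(copyMaps F G) : ℝ) =
      ∑ φ : V ↪ Fin n, (supersetCount U m (edges (G.map φ)) : ℝ) := by
    simp_rw [card_copyMaps_eq_containCount]
    rw [sum_graphsWithEdges n m fun S => (#{φ : V ↪ Fin n | edges (G.map φ) ⊆ S} : ℝ)]
    simp_rw [supersetCount, card_filter, Nat.cast_sum]
    exact sum_comm
  rw [hsum]
  calc Fintype.card (V ↪ Fin n) * ((m : ℝ) / n.choose 2) ^ numEdges G *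
        (1 - (numEdges G : ℝ) ^ 2 / m) * (n.choose 2).choose m
      = ∑ φ : V ↪ Fin n, ((n.choose 2).choose m *
          (((m : ℝ) / n.choose 2) ^ numEdges G * (1 - (numEdges G : ℝ) ^ 2 / m))) := by
        rw [sum_const, card_univ, nsmul_eq_mul]
        ring
    _ ≤ _ := by
        refine sum_le_sum fun φ _ => ?_
        have hc : #(edges (G.map φ)) = numEdges G := by rw [card_edges, numEdges_map]
        have := supersetCount_ge (U := U) (A := edges (G.map φ)) (m := m) (by omega)
          (edges_subset_edges.2 le_top) (by omega) hm0
        rwa [hc, hUc] at this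

lemma uniformProb_copyMaps_ge_le (G : SimpleGraph V) {n m : ℕ} (hm : m ≤ n.choose 2) (k : ℕ)
    (R t : ℝ) (ht : 0 < t)
    (hR : ∀ F : SimpleGraph (Fin n), numEdges F ≤ k * numEdges G →
      ∑ φ : V ↪ Fin n, ((m : ℝ) / n.choose 2) ^ numEdges (G.map φ \ F) ≤ R) :
    uniformProb (graphsWithEdges n m) {F | t ≤ (#(copyMaps F G) : ℝ)} ≤ (R / t) ^ (k + 1) := by
  classical
  have hUc := card_edges_top n
  have hpos : (0 : ℝ) < (n.choose 2).choose m := by exact_mod_cast Nat.choose_pos hm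
  have h := card_containCount_ge_le (U := edges (⊤ : SimpleGraph (Fin n))) (m := m) (by omega)
    (fun φ : V ↪ Fin n => edges (G.map φ)) (fun φ => edges_subset_edges.2 le_top)
    (numEdges G) k (fun φ => by rw [card_edges, numEdges_map]) R t ht (by
      intro A hA hcard
      obtain ⟨F, rfl⟩ := exists_edges_eq hA
      rw [card_edges] at hcard
      simpa only [card_edges_sdiff, hUc] using hR F hcard)
  rw [uniformProb, card_graphsWithEdges, div_le_iff₀ hpos, ← hUc]
  refine le_trans (le_of_eq ?_) h
  rw [card_filter, card_filter, Nat.cast_sum, Nat.cast_sum]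
  simp_rw [Set.mem_ofPred_eq, card_copyMaps_eq_containCount]
  exact sum_graphsWithEdges n m fun S =>
    (((if t ≤ (#{φ : V ↪ Fin n | edges (G.map φ) ⊆ S} : ℝ) then 1 else 0 : ℕ)) : ℝ)

lemma one_add_div_le_mul_exp {ε : ℝ} (h0 : 0 ≤ ε) (h1 : ε ≤ 1) :
    (1 + ε / 9) / ((1 - ε / 9) * (1 + ε)) ≤ Real.exp (-(ε / 9)) := by
  have hpos : 0 < (1 - ε / 9) * (1 + ε) := by
    apply mul_pos <;> linarith
  rw [div_le_iff₀ hpos]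
  have hexp : 1 - ε / 9 ≤ Real.exp (-(ε / 9)) := by
    have := Real.add_one_le_exp (-(ε / 9))
    linarith
  -- To first order, the gain ε exceeds the three losses of ε / 9.
  calc 1 + ε / 9 ≤ (1 - ε / 9) * ((1 - ε / 9) * (1 + ε)) := by
        nlinarith [mul_nonneg h0 (sub_nonneg.2 h1), pow_nonneg h0 3]
    _ ≤ _ := by gcongr

lemma numEdges_eq_zero {G : SimpleGraph V} : numEdges G = 0 ↔ G = ⊥ := by
  rw [numEdges, Set.ncard_eq_zero (Set.toFinite _), SimpleGraph.edgeSet_eq_empty]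

/-- For edgeless G the count is a positive constant, so it never exceeds its mean by a factor 1 + ε.
-/
lemma uniformProb_copyCount_bot {n m : ℕ} (hn : Fintype.card V ≤ n) (hm : m ≤ n.choose 2)
    {ε : ℝ} (hε : 0 < ε) :
    uniformProb (graphsWithEdges n m)
      {F | uniformMean (graphsWithEdges n m)
          (fun F' => (F'.copyCount (⊥ : SimpleGraph V) : ℝ)) * (1 + ε) ≤
        (F.copyCount (⊥ : SimpleGraph V) : ℝ)} = 0 := by
  classical
  have hconst : ∀ F : SimpleGraph (Fin n), F.copyCount (⊥ : SimpleGraph V) =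
      (⊥ : SimpleGraph (Fin n)).copyCount (⊥ : SimpleGraph V) := by
    intro F
    refine Nat.eq_of_mul_eq_mul_right (natCard_iso_self_pos (⊥ : SimpleGraph V)) ?_
    have huniv : ∀ F : SimpleGraph (Fin n), copyMaps F (⊥ : SimpleGraph V) = univ := fun F =>
      eq_univ_iff_forall.2 fun φ => by
        rw [mem_copyMaps, SimpleGraph.map_le_iff_le_comap]
        exact bot_le
    rw [← card_copyMaps_eq_copyCount_mul, ← card_copyMaps_eq_copyCount_mul, huniv, huniv]
  have hq : 0 < (⊥ : SimpleGraph (Fin n)).copyCount (⊥ : SimpleGraph V) := by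
    rw [SimpleGraph.copyCount_pos, SimpleGraph.bot_isContained_iff_card_le, Fintype.card_fin]
    exact hn
  have hcard : ((#(graphsWithEdges n m) : ℕ) : ℝ) ≠ 0 := by
    rw [card_graphsWithEdges]
    exact_mod_cast (Nat.choose_pos hm).ne'
  rw [uniformProb, div_eq_zero_iff]
  left
  rw [Nat.cast_eq_zero, card_eq_zero, filter_eq_empty_iff]
  intro F _ hF
  rw [Set.mem_ofPred_eq, uniformMean] at hF
  simp_rw [hconst] at hF
  rw [sum_const, nsmul_eq_mul, mul_div_cancel_left₀ _ hcard] at hF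
  have : (0 : ℝ) < (⊥ : SimpleGraph (Fin n)).copyCount (⊥ : SimpleGraph V) := by
    exact_mod_cast hq
  nlinarith

end UpperTail

theorem mainTheorem8 {V : Type*} [Fintype V] (G : SimpleGraph V) :
    ∃ c : ℝ, 0 < c ∧
      ∀ (ε : ℝ) (n m : ℕ), 0 ≤ ε → ε ≤ 1 →
        Fintype.card V ≤ n → m ≤ n.choose 2 → 9 * (numEdges G : ℝ) ^ 2 / ε ≤ (m : ℝ) →
        uniformProb (graphsWithEdges n m)
            {F | uniformMean (graphsWithEdges n m) (fun F' => (F'.copyCount G : ℝ)) * (1 + ε) ≤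
              (F.copyCount G : ℝ)} ≤
          Real.exp (-c * ε ^ 2 * (MStar G n ((m : ℝ) / (n.choose 2 : ℝ)) : ℝ)) := by
  classical
  obtain ⟨C, hC0, hC⟩ := exists_sum_pow_le G
  set e := numEdges G with he
  -- Graphs with at most δεM edges then have at most M edges and raise the sum by a factor of at
  -- most 1 + C * δ * ε ≤ 1 + ε / 9.
  set δ : ℝ := 1 / (9 * (C + 1)) with hδ
  have hδ0 : 0 < δ := by positivity
  have hδ1 : δ ≤ 1 := by
    rw [hδ, div_le_one (by positivity)]
    linarith
  have hCδ : C * δ ≤ 1 / 9 := by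
    rw [hδ, mul_one_div, div_le_div_iff₀ (by positivity) (by norm_num)]
    linarith
  -- The exponent is (ε / 9) * (δεM / e), with e + 1 for e so that the constant also makes sense
  -- when e = 0.
  refine ⟨δ / (9 * (e + 1)), by positivity, ?_⟩
  intro ε n m hε0 hε1 hn hm hmε
  rcases hε0.eq_or_lt with rfl | hε
  · simpa using uniformProb_le_one _ _
  rcases Nat.eq_zero_or_pos e with h0 | he0
  · rw [he, numEdges_eq_zero] at h0
    rw [h0, uniformProb_copyCount_bot hn hm hε]
    positivity
  set p : ℝ := (m : ℝ) / (n.choose 2 : ℝ) with hp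
  set M := MStar G n p with hMdef
  rcases Nat.eq_zero_or_pos M with hM0 | hM
  · rw [hM0]
    simpa using uniformProb_le_one _ _
  have heR : (1 : ℝ) ≤ e := by exact_mod_cast he0
  have hmε' : 9 * (e : ℝ) ^ 2 ≤ m * ε := by rwa [div_le_iff₀ hε] at hmε
  have hm9 : (e : ℝ) ≤ m := by nlinarith [Nat.cast_nonneg (α := ℝ) m]
  have hem : e ≤ m := by exact_mod_cast hm9
  have hm0 : 0 < m := by omega
  have hmR : (0 : ℝ) < m := by exact_mod_cast hm0
  have hNR : (0 : ℝ) < n.choose 2 := by exact_mod_cast hm0.trans_le hm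
  have hp0 : 0 < p := div_pos hmR hNR
  have hMR : (0 : ℝ) < M := by exact_mod_cast hM
  have hT : (0 : ℝ) < Fintype.card (V ↪ Fin n) := by
    rw [Fintype.card_embedding_eq, Fintype.card_fin]
    exact_mod_cast Nat.descFactorial_pos.2 hn
  set T : ℝ := (Fintype.card (V ↪ Fin n) : ℝ)
  have hTp : 0 < T * p ^ e := by positivity
  -- The most copies of G whose union is sure to have at most δεM edges; the moment used is the (k +
  -- 1)-st.
  set k := ⌊δ * ε * M / e⌋₊ with hk
  have hke : (k : ℝ) * e ≤ δ * ε * M := by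
    rw [← le_div_iff₀ (by linarith)]
    exact Nat.floor_le (by positivity)
  have hk1 : δ * ε * M / e ≤ (k + 1 : ℕ) := by
    push_cast
    exact (Nat.lt_floor_add_one _).le
  -- A lower bound for 1 + ε times the mean number of labelled copies, as m ≥ 9e² / ε.
  set t : ℝ := T * p ^ e * ((1 - ε / 9) * (1 + ε)) with ht
  have ht0 : 0 < t := by
    refine mul_pos hTp (mul_pos ?_ ?_) <;> linarith
  have htail := uniformProb_copyMaps_ge_le G hm k (T * p ^ e * (1 + ε / 9)) t ht0 (by
    intro F hF
    have hFR : (numEdges F : ℝ) ≤ δ * ε * M := by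
      refine le_trans ?_ hke
      exact_mod_cast hF
    have hFM : numEdges F ≤ M := by
      have : (numEdges F : ℝ) ≤ M := by
        refine hFR.trans (mul_le_of_le_one_left hMR.le ?_)
        exact mul_le_one₀ hδ1 hε0 hε1
      exact_mod_cast this
    refine (hC n p hn hp0.le hM F hFM).trans ?_
    gcongr
    calc C * (numEdges F / M : ℝ) ≤ C * (δ * ε) := by
          gcongr
          rwa [div_le_iff₀ hMR]
      _ = C * δ * ε := by ring
      _ ≤ 1 / 9 * ε := by gcongr
      _ = ε / 9 := by ring)
  have hratio : T * p ^ e * (1 + ε / 9) / t ≤ Real.exp (-(ε / 9)) := by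
    rw [ht, mul_div_mul_left _ _ hTp.ne']
    exact one_add_div_le_mul_exp hε0 hε1
  have hmean := uniformMean_copyMaps_ge G hm hm0 hem
  have hsq : (e : ℝ) ^ 2 / m ≤ ε / 9 := by
    rw [div_le_div_iff₀ hmR (by norm_num)]
    linarith
  set a : ℝ := (Nat.card (G ≃g G) : ℝ) with ha
  have ha0 : 0 < a := Nat.cast_pos.2 (natCard_iso_self_pos G)
  have hcopy : ∀ F : SimpleGraph (Fin n),
      ((copyMaps F G).card : ℝ) = (F.copyCount G : ℝ) * a := by
    intro F
    rw [card_copyMaps_eq_copyCount_mul]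
    push_cast
    rfl
  have hsub : uniformProb (graphsWithEdges n m)
      {F | uniformMean (graphsWithEdges n m) (fun F' => (F'.copyCount G : ℝ)) * (1 + ε) ≤
        (F.copyCount G : ℝ)} ≤
      uniformProb (graphsWithEdges n m) {F | t ≤ ((copyMaps F G).card : ℝ)} := by
    refine uniformProb_mono _ fun F hF => ?_
    rw [Set.mem_ofPred_eq] at hF ⊢
    have hmeq : uniformMean (graphsWithEdges n m) (fun F => ((copyMaps F G).card : ℝ)) =
        uniformMean (graphsWithEdges n m) (fun F' => (F'.copyCount G : ℝ)) * a := by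
      simp_rw [uniformMean, hcopy, ← Finset.sum_mul]
      ring
    rw [hmeq] at hmean
    calc t = T * p ^ e * (1 - ε / 9) * (1 + ε) := by rw [ht]; ring
      _ ≤ T * p ^ e * (1 - (e : ℝ) ^ 2 / m) * (1 + ε) := by gcongr
      _ ≤ uniformMean (graphsWithEdges n m) (fun F' => (F'.copyCount G : ℝ)) * a * (1 + ε) := by
          gcongr
      _ = uniformMean (graphsWithEdges n m) (fun F' => (F'.copyCount G : ℝ)) * (1 + ε) * a := by
          ring
      _ ≤ F.copyCount G * a := by gcongr
      _ = _ := (hcopy F).symm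
  refine hsub.trans (htail.trans ?_)
  calc (T * p ^ e * (1 + ε / 9) / t) ^ (k + 1) ≤ Real.exp (-(ε / 9)) ^ (k + 1) := by
        gcongr
    _ = Real.exp ((k + 1 : ℕ) * -(ε / 9)) := (Real.exp_nat_mul _ _).symm
    _ ≤ _ := by
        rw [Real.exp_le_exp]
        have h1 : δ * ε * M / (e + 1) ≤ (k + 1 : ℕ) :=
          le_trans (by gcongr; linarith) hk1
        calc ((k + 1 : ℕ) : ℝ) * -(ε / 9) ≤ δ * ε * M / (e + 1) * -(ε / 9) :=
              mul_le_mul_of_nonpos_right h1 (by linarith)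
          _ = _ := by field_simp
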